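/- **Setting.** A *probabilistic control-flow graph* (pCFG) $\mathcal C$ consists of a finite set $L$ of locations with an initial location $\ell_{\mathit{init}}$ and a terminal location $\ell_{\mathit{out}}$, a finite set $V$ of real-valued program variables, and a finite set $\Delta$ of transitions. Each transition $\tau$ has a source location $\ell$ and is either - a *probabilistic branching*: a probability distribution $\delta$ over successor locations whose support has exactly two elements, with guard $G(\tau)=\mathbb R^V$ and no variable update; or - a transition with a single target location $\ell'$, a Borel guard $G(\tau)\subseteq\mathbb R^V$ and an update, which is one of: no update; $x_i:=u(\mathbf x,r)$ with $u$ Borel measurable and $r$ sampled from a fixed integrable probability distribution $d$ on $\mathbb R$; or $x_i:=$ a nondeterministically chosen element of a fixed nonempty bounded interval $R$. All transitions leaving $\ell_{\mathit{out}}$ are self-loops. A *state* is a pair $(\ell,\mathbf x)\in L\times\mathbb R^V$; $\tau$ is *enabled* in it if $\ell$ is the source of $\tau$ and $\mathbf x\in G(\tau)$. A *successor* of a state is a possible result of executing an enabled transition (branching: any location in the support of $\delta$; sampling: any $r$ in the support of $d$; nondeterministic update: any value in $R$). A *finite path* is a finite sequence of states that starts in location $\ell_{\mathit{init}}$ (with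 any valuation) and in which each state is a successor of the previous one; a state is *reachable* if some finite path ends in it. An *invariant* $I$ assigns to each location a Borel set $I(\ell)\subseteq\mathbb R^V$ such that $\mathbf x\in I(\ell)$ for all reachable $(\ell,\mathbf x)$. A *measurable scheduler* $\sigma$ assigns, measurably, to each finite path a probability distribution over the transitions enabled in its last state, and, for each such transition with a nondeterministic update from $R$, a probability distribution over $R$. With an initial valuation $\mathbf x_{\mathit{init}}$ it determines the law $\mathbb P^\sigma_{\ell_{\mathit{init}},\mathbf x_{\mathit{init}}}$ of the run started in $(\ell_{\mathit{init}},\mathbf x_{\mathit{init}})$. The pCFG *terminates almost surely* if for every measurable scheduler $\sigma$ and every $\mathbf x_{\mathit{init}}$ the run visits $\ell_{\mathit{out}}$ with $\mathbb P^\sigma_{\ell_{\mathit{init}},\mathbf x_{\mathit{init}}}$-probability $1$. **Pre-expectations.** Let $\eta$ map states to reals, Borel measurably in the valuation, let $S$ be a set of states, and let $\tau$ have source $\ell$. The *maximal pre-expectation* $\text{max-pre}^\tau_{\eta,S}(\ell,\mathbf x)\in[-\infty,\infty]$ is $\sum_{\ell'}\delta(\ell')\,\eta(\ell',\mathbf x)\mathbb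 I_S(\ell',\mathbf x)$ for a branching; $\eta(\ell',\mathbf x)\mathbb I_S(\ell',\mathbf x)$ if there is no update; $\mathbb E_{r\sim d}\big[(\eta\cdot\mathbb I_S)(\ell',\mathbf x(i\leftarrow u(\mathbf x,r)))\big]$ for an update by $u$; and $\sup\{\eta(\ell',\mathbf x(i\leftarrow y)) : y\in R,\ (\ell',\mathbf x(i\leftarrow y))\in S\}$ for a nondeterministic update. The *minimal pre-expectation* $\text{min-pre}^\tau_{\eta,S}$ is defined in the same way with $\inf$ in place of $\sup$. Here $\inf\emptyset=+\infty$, expectations are extended-real valued, and an inequality that involves an expectation of the form $\infty-\infty$ counts as violated. The subscript $S$ is omitted if $S$ is the set of all states. **GLexRSM maps.** For $\mathsf{lev}:\Delta\to\{0,\dots,n\}$, the level of a state is the largest level of a transition enabled in it ($0$ if there is none), and $S^{\le j}_{\mathsf{lev}}$ is the set of states of level at most $j$. Let $\eta=(\eta_1,\dots,\eta_n)$, where each $\eta_j$ maps states to reals, Borel measurably in the valuation. It is a *GLexRSM map supported by $I$* if there is $\mathsf{lev}:\Delta\to\{0,\dots,n\}$ such that $\mathsf{lev}(\tau)=0$ iff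 $\tau$ is a self-loop at $\ell_{\mathit{out}}$, and for each transition $\tau$ with source $\ell\ne\ell_{\mathit{out}}$ and each $\mathbf x\in I(\ell)\cap G(\tau)$: 1. (P-RANK) $\text{max-pre}^\tau_{\eta_{\mathsf{lev}(\tau)}}(\ell,\mathbf x)\le\eta_{\mathsf{lev}(\tau)}(\ell,\mathbf x)-1$, and $\text{max-pre}^\tau_{\eta_j}(\ell,\mathbf x)\le\eta_j(\ell,\mathbf x)$ for all $1\le j<\mathsf{lev}(\tau)$; 2. (P-NNEG) $\eta_j(\ell,\mathbf x)\ge0$ for all $1\le j\le\mathsf{lev}(\tau)$; 3. (EXP-NNEG) $\text{min-pre}^\tau_{\eta_j,S^{\le j-1}_{\mathsf{lev}}}(\ell,\mathbf x)\ge0$ for all $1\le j\le\mathsf{lev}(\tau)$. **Theorem.** Let $\mathcal C$ be a pCFG and $I$ an invariant in $\mathcal C$. If, for some $n\in\mathbb N$, $\mathcal C$ admits an $n$-dimensional GLexRSM map supported by $I$, then $\mathcal C$ terminates almost surely. -/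

import Mathlib

open MeasureTheory ProbabilityTheory

noncomputable section

namespace GLexRSM

/-- The effect of a transition on the valuation `x : V → ℝ` of the program variables. -/
inductive Update (V : Type*) where
  /-- No variable is changed. -/
  | skip : Update V
  /-- `x i := u (x, r)` with `u` Borel and `r` sampled from the integrable distribution `d`.
  A sampling-free expression is one that ignores `r`. -/
  | expr (i : V) (u : (V → ℝ) × ℝ → ℝ) (measurable_u : Measurable u)
      (d : ProbabilityMeasure ℝ) (integrable_d : Integrable (fun r : ℝ => r) (d : Measure ℝ)) :
      Update V
  /-- `x i` is chosen nondeterministically in the nonempty bounded interval `R`. -/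
  | ndet (i : V) (R : Set ℝ) (nonempty_R : R.Nonempty) (interval_R : R.OrdConnected)
      (bounded_R : Bornology.IsBounded R) : Update V

/-- What a transition does: either probabilistic branching between two locations (no guard, no
update), or a move to a single target location with a Borel guard and an update. -/
inductive Action (L V : Type*) where
  | branch (δ : PMF L) (card_support : δ.support.ncard = 2) : Action L V
  | move (target : L) (guard : Set (V → ℝ)) (measurable_guard : MeasurableSet guard)
      (up : Update V) : Action L V

/-- The set of valuations that satisfy the guard. -/
def Action.guard {L V : Type*} : Action L V → Set (V → ℝ)
  | .branch _ _ => Set.univ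
  | .move _ g _ _ => g

/-- The set of successor locations. -/
def Action.targets {L V : Type*} : Action L V → Set L
  | .branch δ _ => δ.support
  | .move ℓ' _ _ _ => {ℓ'}

/-- Probabilistic control-flow graphs with locations `L`, variables `V`, transitions `Δ`. -/
structure PCFG (L V Δ : Type*) where
  /-- initial location -/
  init : L
  /-- terminal location -/
  out : L
  /-- source location of a transition -/
  src : Δ → L
  act : Δ → Action L V
  /-- All transitions that leave the terminal location are self-loops. -/
  out_loop : ∀ τ, src τ = out → (act τ).targets = {out}

/-- States: a location and a valuation. -/
abbrev State (L V : Type*) := L × (V → ℝ)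

/-- Sequences of `n + 1` states, indexed by `0, …, n`. -/
abbrev Hist (L V : Type*) (n : ℕ) := (_ : Finset.Iic n) → State L V

/-- The last state of a sequence. -/
def Hist.last {L V : Type*} {n : ℕ} (h : Hist L V n) : State L V :=
  h ⟨n, Finset.mem_Iic.2 le_rfl⟩

lemma measurable_last {L V : Type*} [MeasurableSpace L] (n : ℕ) :
    Measurable (Hist.last : Hist L V n → State L V) :=
  measurable_pi_apply _

section Semantics

variable {L V Δ : Type*} [DecidableEq V]

/-- `x'` is a possible result of the update `up` on `x`. -/
def Update.Result (up : Update V) (x x' : V → ℝ) : Prop :=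
  match up with
  | .skip => x' = x
  | .expr i u _ d _ => ∃ r ∈ (d : Measure ℝ).support, x' = Function.update x i (u (x, r))
  | .ndet i R _ _ _ => ∃ y ∈ R, x' = Function.update x i y

/-- `s'` is a possible result of the action `a` on a state with valuation `x`. -/
def Action.Result (a : Action L V) (x : V → ℝ) (s' : State L V) : Prop :=
  match a with
  | .branch δ _ => s'.1 ∈ δ.support ∧ s'.2 = x
  | .move ℓ' _ _ up => s'.1 = ℓ' ∧ up.Result x s'.2

namespace PCFG

def Enabled (C : PCFG L V Δ) (τ : Δ) (s : State L V) : Prop :=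
  C.src τ = s.1 ∧ s.2 ∈ (C.act τ).guard

/-- `s'` is a successor of `s`. -/
def Succ (C : PCFG L V Δ) (s s' : State L V) : Prop :=
  ∃ τ, C.Enabled τ s ∧ (C.act τ).Result s.2 s'

/-- Finite paths: they start in the initial location, and each state is a successor of the
previous one. -/
def IsFinitePath (C : PCFG L V Δ) {n : ℕ} (h : Hist L V n) : Prop :=
  (h ⟨0, Finset.mem_Iic.2 (Nat.zero_le n)⟩).1 = C.init ∧
  ∀ (i : ℕ) (hi : i + 1 ≤ n),
    C.Succ (h ⟨i, Finset.mem_Iic.2 ((Nat.le_succ i).trans hi)⟩) (h ⟨i + 1, Finset.mem_Iic.2 hi⟩)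

def Reachable (C : PCFG L V Δ) (s : State L V) : Prop :=
  ∃ (n : ℕ) (h : Hist L V n), C.IsFinitePath h ∧ h.last = s

/-- Invariants: Borel over-approximations of the reachable states. -/
def IsInvariant (C : PCFG L V Δ) (I : L → Set (V → ℝ)) : Prop :=
  (∀ ℓ, MeasurableSet (I ℓ)) ∧ ∀ s, C.Reachable s → s.2 ∈ I s.1

end PCFG

/-! ### Schedulers and the measure on runs -/

/-- Measurable (history-dependent, randomized) schedulers. On sequences of states that are not
finite paths the values are irrelevant and unconstrained. -/
structure Scheduler [MeasurableSpace L] (C : PCFG L V Δ) where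
  /-- the distribution over transitions -/
  trans : (n : ℕ) → Hist L V n → PMF Δ
  measurable_trans : ∀ n τ, Measurable fun h => trans n h τ
  trans_enabled : ∀ n (h : Hist L V n), C.IsFinitePath h →
    ∀ τ ∈ (trans n h).support, C.Enabled τ h.last
  /-- the distribution used by a transition with a nondeterministic update -/
  val : (n : ℕ) → Δ → Kernel (Hist L V n) ℝ
  isMarkov_val : ∀ n τ, IsMarkovKernel (val n τ)
  val_mem : ∀ n (h : Hist L V n) τ, C.IsFinitePath h → C.Enabled τ h.last →
    ∀ ℓ' g hg i R h₁ h₂ h₃, C.act τ = .move ℓ' g hg (.ndet i R h₁ h₂ h₃) →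
      ∀ᵐ y ∂(val n τ h), y ∈ R

/-- The law of the valuation after the update `up` of `x`, if nondeterministic values are drawn
from `q`. -/
def Update.law (up : Update V) (x : V → ℝ) (q : Measure ℝ) : Measure (V → ℝ) :=
  match up with
  | .skip => Measure.dirac x
  | .expr i u _ d _ => (d : Measure ℝ).map fun r => Function.update x i (u (x, r))
  | .ndet i _ _ _ _ => q.map fun y => Function.update x i y

/-- The law of the state after the action `a` on a state with valuation `x`. -/
def Action.law [MeasurableSpace L] (a : Action L V) (x : V → ℝ) (q : Measure ℝ) :
    Measure (State L V) :=
  match a with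
  | .branch δ _ => δ.toMeasure.map fun ℓ' => (ℓ', x)
  | .move ℓ' _ _ up => (up.law x q).map fun x' => (ℓ', x')

lemma measurable_update_uncurry (i : V) :
    Measurable fun p : (V → ℝ) × ℝ => Function.update p.1 i p.2 := by
  refine measurable_pi_lambda _ fun j => ?_
  by_cases h : j = i
  · subst h; simpa using measurable_snd
  · simpa [Function.update_of_ne h, Function.comp_def] using
      (measurable_pi_apply j).comp (measurable_fst (α := V → ℝ) (β := ℝ))

lemma measurable_expr (i : V) {u : (V → ℝ) × ℝ → ℝ} (hu : Measurable u) :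
    Measurable fun p : (V → ℝ) × ℝ => Function.update p.1 i (u p) :=
  (measurable_update_uncurry i).comp (measurable_fst.prodMk hu)

lemma Update.isProbabilityMeasure_law (up : Update V) (x : V → ℝ) (q : Measure ℝ)
    [IsProbabilityMeasure q] : IsProbabilityMeasure (up.law x q) := by
  cases up with
  | skip => exact Measure.dirac.isProbabilityMeasure
  | expr i u hu d hd =>
    exact Measure.isProbabilityMeasure_map
      ((measurable_expr i hu).comp measurable_prodMk_left).aemeasurable
  | ndet i R h₁ h₂ h₃ =>
    exact Measure.isProbabilityMeasure_map
      ((measurable_update_uncurry i).comp measurable_prodMk_left).aemeasurable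

lemma Action.isProbabilityMeasure_law [MeasurableSpace L] (a : Action L V) (x : V → ℝ)
    (q : Measure ℝ) [IsProbabilityMeasure q] : IsProbabilityMeasure (a.law x q) := by
  cases a with
  | branch δ h => exact Measure.isProbabilityMeasure_map measurable_prodMk_right.aemeasurable
  | move ℓ' g hg up =>
    have := up.isProbabilityMeasure_law x q
    exact Measure.isProbabilityMeasure_map measurable_prodMk_left.aemeasurable

lemma Update.measurable_law {H : Type*} [MeasurableSpace H] (up : Update V) {f : H → V → ℝ}
    (hf : Measurable f) (κ : Kernel H ℝ) [IsMarkovKernel κ] :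
    Measurable fun h => up.law (f h) (κ h) := by
  cases up with
  | skip => exact Measure.measurable_dirac.comp hf
  | expr i u hu d hd =>
    refine Measure.measurable_of_measurable_coe _ fun A hA => ?_
    have hm := measurable_expr i hu
    have : ∀ h, Update.law (.expr i u hu d hd) (f h) (κ h) A =
        (d : Measure ℝ) (Prod.mk (f h) ⁻¹'
          ((fun p : (V → ℝ) × ℝ => Function.update p.1 i (u p)) ⁻¹' A)) := fun h =>
      Measure.map_apply (hm.comp measurable_prodMk_left) hA
    simp_rw [this]
    exact (measurable_measure_prodMk_left (hm hA)).comp hf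
  | ndet i R h₁ h₂ h₃ =>
    refine Measure.measurable_of_measurable_coe _ fun A hA => ?_
    have hm : Measurable fun p : H × ℝ => Function.update (f p.1) i p.2 :=
      (measurable_update_uncurry i).comp ((hf.comp measurable_fst).prodMk measurable_snd)
    have : ∀ h, Update.law (.ndet i R h₁ h₂ h₃) (f h) (κ h) A =
        κ h (Prod.mk h ⁻¹' ((fun p : H × ℝ => Function.update (f p.1) i p.2) ⁻¹' A)) := fun h =>
      Measure.map_apply (hm.comp measurable_prodMk_left) hA
    simp_rw [this]
    exact Kernel.measurable_kernel_prodMk_left (hm hA)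

lemma Action.measurable_law [MeasurableSpace L] {H : Type*} [MeasurableSpace H]
    (a : Action L V) {f : H → V → ℝ} (hf : Measurable f) (κ : Kernel H ℝ) [IsMarkovKernel κ] :
    Measurable fun h => a.law (f h) (κ h) := by
  cases a with
  | branch δ hδ =>
    refine Measure.measurable_of_measurable_coe _ fun A hA => ?_
    have : ∀ h, Action.law (.branch δ hδ) (f h) (κ h) A =
        δ.toMeasure ((fun ℓ' => (ℓ', f h)) ⁻¹' A) := fun h =>
      Measure.map_apply measurable_prodMk_right hA
    simp_rw [this]
    exact (measurable_measure_prodMk_right hA).comp hf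
  | move ℓ' g hg up =>
    exact (Measure.measurable_map _ measurable_prodMk_left).comp (up.measurable_law hf κ)

namespace Scheduler

variable [MeasurableSpace L] [Fintype Δ] {C : PCFG L V Δ}

/-- One step of the program: a transition is drawn by the scheduler, then executed. -/
def step (σ : Scheduler C) (n : ℕ) : Kernel (Hist L V n) (State L V) where
  toFun h := ∑ τ, σ.trans n h τ • (C.act τ).law h.last.2 (σ.val n τ h)
  measurable' := by
    refine Measure.measurable_of_measurable_coe _ fun A hA => ?_
    simp only [Measure.coe_finsetSum, Finset.sum_apply, Measure.smul_apply, smul_eq_mul]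
    refine Finset.measurable_sum _ fun τ _ => (σ.measurable_trans n τ).mul ?_
    have := σ.isMarkov_val n τ
    exact (Measure.measurable_coe hA).comp
      ((C.act τ).measurable_law (measurable_snd.comp (measurable_last n)) (σ.val n τ))

instance (σ : Scheduler C) (n : ℕ) : IsMarkovKernel (σ.step n) where
  isProbabilityMeasure h := by
    constructor
    change (∑ τ, σ.trans n h τ • (C.act τ).law h.last.2 (σ.val n τ h)) Set.univ = 1
    have key : ∀ τ, (C.act τ).law h.last.2 (σ.val n τ h) Set.univ = 1 := fun τ => by
      have := σ.isMarkov_val n τ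
      have := (C.act τ).isProbabilityMeasure_law h.last.2 (σ.val n τ h)
      exact measure_univ
    simp only [Measure.coe_finsetSum, Finset.sum_apply, Measure.smul_apply, smul_eq_mul, key,
      mul_one]
    rw [← tsum_fintype (L := SummationFilter.unconditional _)]
    exact (σ.trans n h).tsum_coe

/-- The law of the run that starts in the initial location with valuation `x`, as a measure on
all infinite sequences of states. -/
def runMeasure (σ : Scheduler C) (x : V → ℝ) : Measure (ℕ → State L V) :=
  Kernel.traj (X := fun _ => State L V) σ.step 0 fun _ => (C.init, x)

end Scheduler

/-- Almost-sure termination under every measurable scheduler and every initial valuation. -/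
def PCFG.TerminatesAlmostSurely [MeasurableSpace L] [Fintype Δ] (C : PCFG L V Δ) : Prop :=
  ∀ (σ : Scheduler C) (x : V → ℝ), σ.runMeasure x {ρ | ∃ n, (ρ n).1 = C.out} = 1

/-! ### Pre-expectations -/

/-- The expectation `E[f⁺] - E[f⁻]` in `[-∞, ∞]`, with value `∞` if it has the form `∞ - ∞`. -/
def upperExp (d : Measure ℝ) (f : ℝ → ℝ) : EReal :=
  -(((∫⁻ r, ENNReal.ofReal (-f r) ∂d : ENNReal) : EReal)
    - ((∫⁻ r, ENNReal.ofReal (f r) ∂d : ENNReal) : EReal))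

/-- The expectation `E[f⁺] - E[f⁻]` in `[-∞, ∞]`, with value `-∞` if it has the form `∞ - ∞`. -/
def lowerExp (d : Measure ℝ) (f : ℝ → ℝ) : EReal :=
  ((∫⁻ r, ENNReal.ofReal (f r) ∂d : ENNReal) : EReal)
    - ((∫⁻ r, ENNReal.ofReal (-f r) ∂d : ENNReal) : EReal)

variable [Fintype L]

/-- Maximal pre-expectation of `f` given the set of states `S`: the maximal expected value of `f`
after the action, computed over the successor states in `S`. -/
def Action.maxPre (a : Action L V) (f : State L V → ℝ) (S : Set (State L V)) (x : V → ℝ) : EReal :=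
  match a with
  | .branch δ _ => ((∑ ℓ', (δ ℓ').toReal * S.indicator f (ℓ', x) : ℝ) : EReal)
  | .move ℓ' _ _ .skip => ((S.indicator f (ℓ', x) : ℝ) : EReal)
  | .move ℓ' _ _ (.expr i u _ d _) =>
      upperExp d fun r => S.indicator f (ℓ', Function.update x i (u (x, r)))
  | .move ℓ' _ _ (.ndet i R _ _ _) =>
      ⨆ y ∈ {y ∈ R | (ℓ', Function.update x i y) ∈ S}, (f (ℓ', Function.update x i y) : EReal)

/-- Minimal pre-expectation of `f` given the set of states `S`. -/
def Action.minPre (a : Action L V) (f : State L V → ℝ) (S : Set (State L V)) (x : V → ℝ) : EReal :=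
  match a with
  | .branch δ _ => ((∑ ℓ', (δ ℓ').toReal * S.indicator f (ℓ', x) : ℝ) : EReal)
  | .move ℓ' _ _ .skip => ((S.indicator f (ℓ', x) : ℝ) : EReal)
  | .move ℓ' _ _ (.expr i u _ d _) =>
      lowerExp d fun r => S.indicator f (ℓ', Function.update x i (u (x, r)))
  | .move ℓ' _ _ (.ndet i R _ _ _) =>
      ⨅ y ∈ {y ∈ R | (ℓ', Function.update x i y) ∈ S}, (f (ℓ', Function.update x i y) : EReal)

/-! ### GLexRSM maps -/

namespace PCFG

variable [Fintype Δ]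

open scoped Classical in
/-- The level of a state: the largest level of a transition enabled there (`0` if there is none). -/
def stateLevel (C : PCFG L V Δ) (lev : Δ → ℕ) (s : State L V) : ℕ :=
  (Finset.univ.filter fun τ => C.Enabled τ s).sup lev

/-- The set of states of level at most `j`. -/
def levelLE (C : PCFG L V Δ) (lev : Δ → ℕ) (j : ℕ) : Set (State L V) :=
  {s | C.stateLevel lev s ≤ j}

/-- `τ` is a self-loop at the terminal location. -/
def IsOutLoop (C : PCFG L V Δ) (τ : Δ) : Prop :=
  C.src τ = C.out ∧ (C.act τ).targets = {C.out}

/-! Components are indexed by `j : Fin n`, so that `j` stands for the component with number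
`j + 1 ∈ {1, …, n}`. -/

def PRank (C : PCFG L V Δ) (I : L → Set (V → ℝ)) {n : ℕ} (η : Fin n → State L V → ℝ)
    (lev : Δ → ℕ) (τ : Δ) : Prop :=
  ∀ x ∈ I (C.src τ) ∩ (C.act τ).guard, ∀ j : Fin n,
    ((j : ℕ) + 1 = lev τ →
      (C.act τ).maxPre (η j) Set.univ x ≤ ((η j (C.src τ, x) - 1 : ℝ) : EReal)) ∧
    ((j : ℕ) + 1 < lev τ →
      (C.act τ).maxPre (η j) Set.univ x ≤ (η j (C.src τ, x) : EReal))

def PNneg (C : PCFG L V Δ) (I : L → Set (V → ℝ)) {n : ℕ} (η : Fin n → State L V → ℝ)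
    (lev : Δ → ℕ) (τ : Δ) : Prop :=
  ∀ x ∈ I (C.src τ) ∩ (C.act τ).guard, ∀ j : Fin n,
    (j : ℕ) + 1 ≤ lev τ → 0 ≤ η j (C.src τ, x)

def ExpNneg (C : PCFG L V Δ) (I : L → Set (V → ℝ)) {n : ℕ} (η : Fin n → State L V → ℝ)
    (lev : Δ → ℕ) (τ : Δ) : Prop :=
  ∀ x ∈ I (C.src τ) ∩ (C.act τ).guard, ∀ j : Fin n,
    (j : ℕ) + 1 ≤ lev τ → 0 ≤ (C.act τ).minPre (η j) (C.levelLE lev j) x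

/-- `η` is an `n`-dimensional GLexRSM map supported by `I`. -/
def IsGLexRSMMap (C : PCFG L V Δ) (I : L → Set (V → ℝ)) {n : ℕ}
    (η : Fin n → State L V → ℝ) : Prop :=
  (∀ j ℓ, Measurable fun x => η j (ℓ, x)) ∧
  ∃ lev : Δ → ℕ, (∀ τ, lev τ ≤ n) ∧ (∀ τ, lev τ = 0 ↔ C.IsOutLoop τ) ∧
    ∀ τ, C.src τ ≠ C.out → C.PRank I η lev τ ∧ C.PNneg I η lev τ ∧ C.ExpNneg I η lev τ

end PCFG

end Semantics

end GLexRSM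

end

open scoped ENNReal Topology

noncomputable section

namespace GLexRSM

/-! ### Sub-Markov kernels: transience and a Lyapunov criterion. -/

section Transience

variable {E : Type*} [MeasurableSpace E]

/-! The usual obstacle for lexicographic ranking is that a component may be negative, without any
lower bound, in states where it is not the active one. The cure is truncation. Let `r` be the
component for level `k + 1`, set to zero at states of level at most `k`. P-NNEG makes `r`
nonnegative at reachable states. EXP-NNEG says that the discarded part of the next expected value is
nonnegative, so discarding it only lowers the expectation. Hence, by P-RANK, `r` does not increase
in mean along transitions of level above `k`, and drops by at least one along those of level `k + 1`
(`PCFG.lintegral_rank_le`).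

This is turned into termination by killing. Since schedulers depend on the history, the process is
viewed as a time-homogeneous one on histories of all lengths. Let it die as soon as a transition of
level at most `k` is chosen. Descending induction on `k` shows that it dies almost surely. For `k =
n` it dies at once. In the inductive step, `IsTransientOn.add` allows the transitions of level `k +
1` in addition: the finite quantity `r` bounds the expected number of such transitions, so almost
surely only finitely many are taken, and after the last one the process with the smaller set of
allowed transitions dies by induction.

At `k = 0`, only transitions of level zero kill, and these start in the terminal location. So the
probability of never terminating is subharmonic for the killed process
(`Scheduler.runKernel_avoid_out_le`), and transience forces it to vanish.

Transience is stated through subharmonic functions, so that no path space for the killed processes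
is needed. It is relative to the finite paths, where the assumptions hold. These need not form a
Borel set, because being a successor involves a projection; hence `Preserves` tests only measurable
supersets. -/

/-- The set `P`, which need not be measurable, is almost surely preserved by the kernel `κ`. -/
def Preserves (κ : Kernel E E) (P : Set E) : Prop :=
  ∀ e ∈ P, ∀ M, MeasurableSet M → P ⊆ M → κ e Mᶜ = 0

/-- The only subharmonic function on `P` with values in `[0, 1]` is zero: a particle that moves
by the sub-Markov kernel `κ` from a point of `P` is almost surely killed. -/
def IsTransientOn (κ : Kernel E E) (P : Set E) : Prop :=
  ∀ v : E → ℝ≥0∞, Measurable v → (∀ e, v e ≤ 1) → (∀ e ∈ P, v e ≤ ∫⁻ e', v e' ∂(κ e)) →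
    ∀ e ∈ P, v e = 0

/-- The set `{f ≤ g}` is a measurable superset of `P`, hence of full measure. This is the only form
in which preservation enters the potential theory below. -/
lemma Preserves.lintegral_mono {κ : Kernel E E} {P : Set E} (hκ : Preserves κ P)
    {f g : E → ℝ≥0∞} (hf : Measurable f) (hg : Measurable g) (hfg : ∀ e ∈ P, f e ≤ g e)
    {e : E} (he : e ∈ P) : ∫⁻ e', f e' ∂(κ e) ≤ ∫⁻ e', g e' ∂(κ e) :=
  lintegral_mono_ae (hκ e he {e' | f e' ≤ g e'} (measurableSet_le hf hg) hfg)

lemma Preserves.add {κ₁ κ₂ : Kernel E E} {P : Set E} (h₁ : Preserves κ₁ P)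
    (h₂ : Preserves κ₂ P) : Preserves (κ₁ + κ₂) P := by
  intro e he M hM hPM
  simp [h₁ e he M hM hPM, h₂ e he M hM hPM]

/-- The action of the powers of a kernel on functions. -/
def iter (κ : Kernel E E) (f : E → ℝ≥0∞) : ℕ → E → ℝ≥0∞
  | 0 => f
  | t + 1 => fun e => ∫⁻ e', iter κ f t e' ∂(κ e)

lemma measurable_iter (κ : Kernel E E) {f : E → ℝ≥0∞} (hf : Measurable f) (t : ℕ) :
    Measurable (iter κ f t) := by
  induction t with
  | zero => exact hf
  | succ t ih => exact ih.lintegral_kernel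

lemma iter_mono {κ : Kernel E E} {P : Set E} (hκ : Preserves κ P) {f g : E → ℝ≥0∞}
    (hf : Measurable f) (hg : Measurable g) (hfg : ∀ e ∈ P, f e ≤ g e) (t : ℕ) :
    ∀ e ∈ P, iter κ f t e ≤ iter κ g t e := by
  induction t with
  | zero => exact hfg
  | succ t ih =>
    exact fun e he => hκ.lintegral_mono (measurable_iter κ hf t) (measurable_iter κ hg t) ih he

lemma iter_le_iter_add (κ₁ κ₂ : Kernel E E) (f : E → ℝ≥0∞) (t : ℕ) (e : E) :
    iter κ₁ f t e ≤ iter (κ₁ + κ₂) f t e := by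
  induction t generalizing e with
  | zero => exact le_rfl
  | succ t ih =>
    simp only [iter, add_apply]
    rw [lintegral_add_measure]
    exact (lintegral_mono ih).trans le_self_add

lemma le_iter {κ : Kernel E E} {P : Set E} (hκ : Preserves κ P) {v : E → ℝ≥0∞}
    (hv : Measurable v) (h : ∀ e ∈ P, v e ≤ ∫⁻ e', v e' ∂(κ e)) (t : ℕ) :
    ∀ e ∈ P, v e ≤ iter κ v t e := by
  induction t with
  | zero => exact fun e _ => le_rfl
  | succ t ih =>
    exact fun e he => (h e he).trans (hκ.lintegral_mono hv (measurable_iter κ hv t) ih he)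

/-- The potential of a function. -/
def potential (κ : Kernel E E) (f : E → ℝ≥0∞) (e : E) : ℝ≥0∞ := ∑' s, iter κ f s e

lemma measurable_potential (κ : Kernel E E) {f : E → ℝ≥0∞} (hf : Measurable f) :
    Measurable (potential κ f) :=
  Measurable.tsum fun s => measurable_iter κ hf s

lemma iter_potential (κ : Kernel E E) {f : E → ℝ≥0∞} (hf : Measurable f) (t : ℕ) (e : E) :
    iter κ (potential κ f) t e = ∑' s, iter κ f (s + t) e := by
  induction t generalizing e with
  | zero => rfl
  | succ t ih =>
    simp only [iter, ih]
    exact lintegral_tsum fun s => (measurable_iter κ hf (s + t)).aemeasurable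

/-- Applying the kernel `t` times shifts the series by `t`, which leaves the tail of a convergent
series. -/
lemma tendsto_iter_potential (κ : Kernel E E) {f : E → ℝ≥0∞} (hf : Measurable f) {e : E}
    (he : potential κ f e ≠ ∞) :
    Filter.Tendsto (fun t => iter κ (potential κ f) t e) Filter.atTop (𝓝 0) := by
  simp only [iter_potential κ hf]
  exact ENNReal.tendsto_sum_nat_add _ he

lemma sum_iter_succ (κ : Kernel E E) {f : E → ℝ≥0∞} (hf : Measurable f) (t : ℕ) (e : E) :
    ∑ s ∈ Finset.range (t + 1), iter κ f s e =
      f e + ∫⁻ e', ∑ s ∈ Finset.range t, iter κ f s e' ∂(κ e) := by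
  rw [Finset.sum_range_succ', add_comm,
    lintegral_finsetSum _ fun s _ => measurable_iter κ hf s]
  rfl

/-- The potential is the least supersolution: by induction, each partial sum satisfies `f + κ
(partial sum) ≤ f + κ g ≤ g`. -/
lemma potential_le {κ : Kernel E E} {P : Set E} (hκ : Preserves κ P) {f g : E → ℝ≥0∞}
    (hf : Measurable f) (hg : Measurable g) (h : ∀ e ∈ P, f e + ∫⁻ e', g e' ∂(κ e) ≤ g e) :
    ∀ e ∈ P, potential κ f e ≤ g e := by
  have key : ∀ t, ∀ e ∈ P, ∑ s ∈ Finset.range t, iter κ f s e ≤ g e := by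
    intro t
    induction t with
    | zero => simp
    | succ t ih =>
      intro e he
      rw [sum_iter_succ κ hf]
      refine le_trans ?_ (h e he)
      refine add_le_add le_rfl ?_
      exact hκ.lintegral_mono (Finset.measurable_sum _ fun s _ => measurable_iter κ hf s) hg ih he
  intro e he
  rw [potential, ENNReal.tsum_eq_iSup_nat]
  exact iSup_le fun t => key t e he

/-- For a transient kernel the probability to survive `t` steps tends to zero. -/
lemma IsTransientOn.tendsto_iter_one {κ : Kernel E E} {P : Set E} (h : IsTransientOn κ P)
    (hsub : ∀ e, κ e Set.univ ≤ 1) {e : E} (he : e ∈ P) :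
    Filter.Tendsto (fun t => iter κ 1 t e) Filter.atTop (𝓝 0) := by
  have hm : ∀ t, Measurable (iter κ 1 t) := measurable_iter κ measurable_one
  have hle : ∀ t e, iter κ 1 (t + 1) e ≤ iter κ 1 t e := by
    intro t
    induction t with
    | zero => intro e; simpa [iter] using hsub e
    | succ t ih => exact fun e => lintegral_mono ih
  have hanti : ∀ e, Antitone fun t => iter κ 1 t e := fun e => antitone_nat_of_succ_le (hle · e)
  have hfin : ∀ t e, iter κ 1 t e ≤ 1 := fun t e => hanti e (Nat.zero_le t)
  -- The limiting survival probability is itself subharmonic with values in `[0, 1]`, by monotone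
  -- passage to the limit under the integral, so transience applies to it.
  have hzero : ⨅ t, iter κ 1 t e = 0 := by
    refine h (fun e => ⨅ t, iter κ 1 t e) (Measurable.iInf hm) (fun e => iInf_le_of_le 0 (hfin 0 e))
      (fun e _ => ?_) e he
    rw [lintegral_iInf hm (fun s t hst e => hanti e hst)
      (ne_top_of_le_ne_top ENNReal.one_ne_top (hfin 1 e))]
    exact le_iInf fun t => iInf_le _ (t + 1)
  rw [← hzero]
  exact tendsto_atTop_iInf (hanti e)

/-- If `κ₁` is transient and `g` is a finite function that decreases in mean along `κ₁ + κ₂`, and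
by at least one at each step of `κ₂`, then `κ₁ + κ₂` is transient. -/
theorem IsTransientOn.add {κ₁ κ₂ : Kernel E E} {P : Set E} (h : IsTransientOn κ₁ P)
    (hP₁ : Preserves κ₁ P) (hP₂ : Preserves κ₂ P) (hsub : ∀ e, κ₁ e Set.univ ≤ 1)
    {g : E → ℝ≥0∞} (hg : Measurable g) (hfin : ∀ e ∈ P, g e ≠ ∞)
    (hdec : ∀ e ∈ P, κ₂ e Set.univ + ∫⁻ e', g e' ∂((κ₁ + κ₂) e) ≤ g e) :
    IsTransientOn (κ₁ + κ₂) P := by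
  intro v hv hv1 hvle e he
  have hP := hP₁.add hP₂
  set q : E → ℝ≥0∞ := fun e => κ₂ e Set.univ with hq
  have hqm : Measurable q := Kernel.measurable_coe κ₂ MeasurableSet.univ
  have hRg := potential_le hP hqm hg hdec
  -- Unrolls `v ≤ κ₁ v + κ₂ v ≤ κ₁ v + q`: either the first `t` steps all belong to `κ₁`, or the
  -- first step of `κ₂` occurs after some `s < t` steps of `κ₁`.
  have hstep : ∀ t, ∀ e ∈ P, v e ≤ iter κ₁ 1 t e + ∑ s ∈ Finset.range t, iter κ₁ q s e := by
    intro t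
    induction t with
    | zero => intro e _; simpa [iter] using hv1 e
    | succ t ih =>
      intro e he
      have hm1 := measurable_iter κ₁ (measurable_one (α := ℝ≥0∞)) t
      have hms : Measurable fun e => ∑ s ∈ Finset.range t, iter κ₁ q s e :=
        Finset.measurable_sum _ fun s _ => measurable_iter κ₁ hqm s
      calc v e ≤ ∫⁻ e', v e' ∂(κ₁ e) + ∫⁻ e', v e' ∂(κ₂ e) := by
            simpa [lintegral_add_measure] using hvle e he
        _ ≤ ∫⁻ e', (iter κ₁ 1 t e' + ∑ s ∈ Finset.range t, iter κ₁ q s e') ∂(κ₁ e) + q e := by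
            refine add_le_add (hP₁.lintegral_mono hv (hm1.add hms) ih he) ?_
            simpa using lintegral_mono (μ := κ₂ e) hv1
        _ = _ := by
            rw [lintegral_add_left hm1, sum_iter_succ κ₁ hqm, add_assoc, add_comm (q e)]
            rfl
  -- As `t → ∞` the survival term vanishes. What remains is at most the expected number of
  -- `κ₂`-steps, which is at most `g`.
  have hvR : ∀ e ∈ P, v e ≤ potential (κ₁ + κ₂) q e := by
    intro e he
    have hlim := (h.tendsto_iter_one hsub he).add_const (potential (κ₁ + κ₂) q e)
    rw [zero_add] at hlim
    refine ge_of_tendsto' hlim fun t => (hstep t e he).trans ?_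
    gcongr
    exact (Finset.sum_le_sum fun s _ => iter_le_iter_add κ₁ κ₂ q s e).trans
      (ENNReal.sum_le_tsum _)
  -- Iterating subharmonicity along the full kernel bounds `v` by the expected number of `κ₂`-steps
  -- after time `t`, which tends to zero.
  have hlim := tendsto_iter_potential (κ₁ + κ₂) hqm
    (ne_top_of_le_ne_top (hfin e he) (hRg e he))
  refine le_antisymm (ge_of_tendsto' hlim fun t => ?_) zero_le
  exact (le_iter hP hv hvle t e he).trans
    (iter_mono hP hv (measurable_potential _ hqm) hvR t e he)

end Transience

/-! ### Pre-expectations against the law of one step. -/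

section OneStep

variable {L V : Type*} [DecidableEq V]

/-- `q` is a possible distribution for the value of a nondeterministic update in the action `a`. -/
def Action.Admissible (a : Action L V) (q : Measure ℝ) : Prop :=
  ∀ ℓ' g hg i R h₁ h₂ h₃, a = .move ℓ' g hg (.ndet i R h₁ h₂ h₃) → ∀ᵐ y ∂q, y ∈ R

lemma measurable_mk_update_expr [MeasurableSpace L] (ℓ' : L) (x : V → ℝ) (i : V)
    {u : (V → ℝ) × ℝ → ℝ} (hu : Measurable u) :
    Measurable fun r : ℝ => ((ℓ', Function.update x i (u (x, r))) : State L V) :=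
  measurable_prodMk_left.comp ((measurable_expr i hu).comp measurable_prodMk_left)

lemma measurable_mk_update [MeasurableSpace L] (ℓ' : L) (x : V → ℝ) (i : V) :
    Measurable fun y : ℝ => ((ℓ', Function.update x i y) : State L V) :=
  measurable_prodMk_left.comp ((measurable_update_uncurry i).comp measurable_prodMk_left)

lemma law_move_skip [MeasurableSpace L] (ℓ' : L) (g : Set (V → ℝ)) (hg : MeasurableSet g)
    (x : V → ℝ) (q : Measure ℝ) :
    (Action.move ℓ' g hg .skip : Action L V).law x q = Measure.dirac (ℓ', x) :=
  Measure.map_dirac' measurable_prodMk_left _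

lemma law_move_expr [MeasurableSpace L] (ℓ' : L) (g : Set (V → ℝ)) (hg : MeasurableSet g)
    (i : V) (u : (V → ℝ) × ℝ → ℝ) (hu : Measurable u) (d : ProbabilityMeasure ℝ)
    (hd : Integrable (fun r : ℝ => r) (d : Measure ℝ)) (x : V → ℝ) (q : Measure ℝ) :
    (Action.move ℓ' g hg (.expr i u hu d hd) : Action L V).law x q =
      (d : Measure ℝ).map fun r => (ℓ', Function.update x i (u (x, r))) :=
  Measure.map_map measurable_prodMk_left ((measurable_expr i hu).comp measurable_prodMk_left)

lemma law_move_ndet [MeasurableSpace L] (ℓ' : L) (g : Set (V → ℝ)) (hg : MeasurableSet g)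
    (i : V) (R : Set ℝ) (h₁ h₂ h₃) (x : V → ℝ) (q : Measure ℝ) :
    (Action.move ℓ' g hg (.ndet i R h₁ h₂ h₃) : Action L V).law x q =
      q.map fun y => (ℓ', Function.update x i y) :=
  Measure.map_map measurable_prodMk_left
    ((measurable_update_uncurry i).comp measurable_prodMk_left)

lemma lintegral_law_branch [Fintype L] [MeasurableSpace L] [DiscreteMeasurableSpace L]
    (δ : PMF L) (hδ) (x : V → ℝ) (q : Measure ℝ) {F : State L V → ℝ≥0∞} (hF : Measurable F) :
    ∫⁻ s, F s ∂((Action.branch δ hδ : Action L V).law x q) = ∑ ℓ', δ ℓ' * F (ℓ', x) := by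
  rw [Action.law, lintegral_map hF measurable_prodMk_right, lintegral_fintype]
  refine Finset.sum_congr rfl fun ℓ' _ => ?_
  rw [PMF.toMeasure_apply_singleton _ _ (measurableSet_singleton ℓ'), mul_comm]

/-- Measurable supersets of the set of possible results have full measure. -/
lemma Action.law_compl_eq_zero [MeasurableSpace L] [DiscreteMeasurableSpace L]
    (a : Action L V) (x : V → ℝ) {q : Measure ℝ} (hq : a.Admissible q) {M : Set (State L V)}
    (hM : MeasurableSet M) (h : ∀ s, a.Result x s → s ∈ M) : a.law x q Mᶜ = 0 := by
  match a, hq, h with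
  | .branch δ hδ, _, h =>
    rw [Action.law, Measure.map_apply measurable_prodMk_right hM.compl,
      PMF.toMeasure_apply_eq_zero_iff _ (measurable_prodMk_right hM.compl)]
    exact Set.disjoint_left.2 fun ℓ' hℓ' hmem => hmem (h (ℓ', x) ⟨hℓ', rfl⟩)
  | .move ℓ' g hg .skip, _, h =>
    rw [law_move_skip, Measure.dirac_apply' _ hM.compl]
    simpa using h (ℓ', x) ⟨rfl, rfl⟩
  | .move ℓ' g hg (.expr i u hu d hd), _, h =>
    rw [law_move_expr, Measure.map_apply (measurable_mk_update_expr ℓ' x i hu) hM.compl]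
    exact measure_eq_zero_iff_ae_notMem.2 (Filter.mem_of_superset
      (d : Measure ℝ).support_mem_ae fun r hr hr' => hr' (h _ ⟨rfl, r, hr, rfl⟩))
  | .move ℓ' g hg (.ndet i R h₁ h₂ h₃), hq, h =>
    rw [law_move_ndet, Measure.map_apply (measurable_mk_update ℓ' x i) hM.compl]
    exact measure_eq_zero_iff_ae_notMem.2 ((hq ℓ' g hg i R h₁ h₂ h₃ rfl).mono
      fun y hy hy' => hy' (h _ ⟨rfl, y, hy, rfl⟩))

/-- Only `S` contributes to the negative part of `f`. With `p`, `m` the integrals of the positive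
and negative parts over `S` and `c` the integral over the complement, the hypotheses read `p + c - m
≤ b` and `0 ≤ p - m`, whence `c ≤ b`. -/
lemma lintegral_le_of_upperExp_le {d : Measure ℝ} {f : ℝ → ℝ} (hf : Measurable f) {S : Set ℝ}
    (hS : MeasurableSet S) (hpos : ∀ᵐ r ∂d, r ∉ S → 0 ≤ f r) {b : ℝ}
    (hup : upperExp d f ≤ (b : EReal)) (hlow : 0 ≤ lowerExp d (S.indicator f)) :
    ∫⁻ r, ENNReal.ofReal (Sᶜ.indicator f r) ∂d ≤ ENNReal.ofReal b ∧ 0 ≤ b := by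
  have hp : ∫⁻ r, ENNReal.ofReal (f r) ∂d =
      ∫⁻ r, ENNReal.ofReal (S.indicator f r) ∂d + ∫⁻ r, ENNReal.ofReal (Sᶜ.indicator f r) ∂d := by
    rw [← lintegral_add_left (hf.indicator hS).ennreal_ofReal]
    refine lintegral_congr fun r => ?_
    by_cases hr : r ∈ S <;> simp [hr]
  have hm : ∫⁻ r, ENNReal.ofReal (-f r) ∂d = ∫⁻ r, ENNReal.ofReal (-S.indicator f r) ∂d := by
    refine lintegral_congr_ae (hpos.mono fun r hr => ?_)
    by_cases hrS : r ∈ S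
    · simp [hrS]
    · simp [hrS, hr hrS]
  unfold upperExp at hup
  unfold lowerExp at hlow
  rw [hm, hp] at hup
  generalize ∫⁻ r, ENNReal.ofReal (S.indicator f r) ∂d = p at *
  generalize ∫⁻ r, ENNReal.ofReal (Sᶜ.indicator f r) ∂d = c at *
  generalize ∫⁻ r, ENNReal.ofReal (-S.indicator f r) ∂d = m at *
  -- The conventions for `∞ - ∞` give finiteness: an infinite positive part makes `upperExp` equal
  -- to `∞`, and an infinite negative part makes `lowerExp` equal to `-∞`.
  have hpc : p + c ≠ ∞ := by
    intro htop
    simp [htop] at hup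
  obtain ⟨hp', hc'⟩ := ENNReal.add_ne_top.1 hpc
  have hm' : m ≠ ∞ := by
    rintro rfl
    simp at hlow
  lift p to NNReal using hp'
  lift c to NNReal using hc'
  lift m to NNReal using hm'
  have hup' : -((m : ℝ) - (p + c)) ≤ b := by
    rw [← ENNReal.coe_add] at hup
    simp only [EReal.coe_nnreal_eq_coe_real] at hup
    exact_mod_cast hup
  have hlow' : (0 : ℝ) ≤ p - m := by
    simp only [EReal.coe_nnreal_eq_coe_real] at hlow
    exact_mod_cast hlow
  have hcb : (c : ℝ) ≤ b := by linarith
  refine ⟨?_, c.2.trans hcb⟩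
  rw [← ENNReal.ofReal_coe_nnreal]
  exact ENNReal.ofReal_le_ofReal hcb

/-- If the values of `f` outside `S` are nonnegative and the expected value inside `S` is
nonnegative, then a bound on the maximal pre-expectation is a bound on the expected value outside
`S`. -/
lemma Action.lintegral_law_le [Fintype L] [MeasurableSpace L] [DiscreteMeasurableSpace L]
    (a : Action L V) (x : V → ℝ) {q : Measure ℝ} [IsProbabilityMeasure q] (hq : a.Admissible q)
    {f : State L V → ℝ} (hf : Measurable f) {S : Set (State L V)} (hS : MeasurableSet S)
    (hpos : ∀ s, a.Result x s → s ∉ S → 0 ≤ f s) {b : ℝ}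
    (hmax : a.maxPre f Set.univ x ≤ (b : EReal)) (hmin : 0 ≤ a.minPre f S x) :
    ∫⁻ s, ENNReal.ofReal (Sᶜ.indicator f s) ∂(a.law x q) ≤ ENNReal.ofReal b ∧ 0 ≤ b := by
  have hF : Measurable fun s => ENNReal.ofReal (Sᶜ.indicator f s) :=
    (hf.indicator hS.compl).ennreal_ofReal
  have hsplit : ∀ s, S.indicator f s + Sᶜ.indicator f s = f s := fun s =>
    congrFun (Set.indicator_self_add_compl S f) s
  match a, hq, hpos, hmax, hmin with
  | .branch δ hδ, _, hpos, hmax, hmin =>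
    simp only [Action.maxPre, Set.indicator_univ, EReal.coe_le_coe_iff] at hmax
    simp only [Action.minPre, EReal.coe_nonneg] at hmin
    have hnn : ∀ ℓ', 0 ≤ (δ ℓ').toReal * Sᶜ.indicator f (ℓ', x) := by
      intro ℓ'
      by_cases hℓ' : ℓ' ∈ δ.support
      · refine mul_nonneg ENNReal.toReal_nonneg (Set.indicator_apply_nonneg fun h => ?_)
        exact hpos _ ⟨hℓ', rfl⟩ h
      · simp [(PMF.apply_eq_zero_iff δ ℓ').2 hℓ']
    have hsum : ∑ ℓ', (δ ℓ').toReal * Sᶜ.indicator f (ℓ', x) ≤ b := by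
      refine le_trans ?_ hmax
      simp_rw [← hsplit, mul_add, Finset.sum_add_distrib]
      exact le_add_of_nonneg_left hmin
    rw [lintegral_law_branch δ hδ x q hF]
    refine ⟨?_, (Finset.sum_nonneg fun ℓ' _ => hnn ℓ').trans hsum⟩
    refine le_trans (le_of_eq ?_) (ENNReal.ofReal_le_ofReal hsum)
    rw [ENNReal.ofReal_sum_of_nonneg fun ℓ' _ => hnn ℓ']
    refine Finset.sum_congr rfl fun ℓ' _ => ?_
    rw [ENNReal.ofReal_mul ENNReal.toReal_nonneg, ENNReal.ofReal_toReal (δ.apply_ne_top ℓ')]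
  | .move ℓ' g hg .skip, _, hpos, hmax, hmin =>
    simp only [Action.maxPre, Set.indicator_univ, EReal.coe_le_coe_iff] at hmax
    simp only [Action.minPre, EReal.coe_nonneg] at hmin
    rw [law_move_skip, lintegral_dirac' _ hF]
    have hpos' := hpos (ℓ', x) ⟨rfl, rfl⟩
    by_cases hs : (ℓ', x) ∈ S
    · simp only [hs, Set.indicator_of_mem] at hmin
      simpa [hs] using hmin.trans hmax
    · simpa [hs] using ⟨ENNReal.ofReal_le_ofReal hmax, (hpos' hs).trans hmax⟩
  | .move ℓ' g hg (.expr i u hu d hd), _, hpos, hmax, hmin =>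
    simp only [Action.maxPre, Set.indicator_univ] at hmax
    have hφ := measurable_mk_update_expr ℓ' x i hu
    rw [law_move_expr, lintegral_map hF hφ]
    refine lintegral_le_of_upperExp_le (hf.comp hφ) (hφ hS) ?_ hmax hmin
    filter_upwards [(d : Measure ℝ).support_mem_ae] with r hr
    exact hpos _ ⟨rfl, r, hr, rfl⟩
  | .move ℓ' g hg (.ndet i R h₁ h₂ h₃), hq, hpos, hmax, hmin =>
    have hle : ∀ y ∈ R, f (ℓ', Function.update x i y) ≤ b := by
      intro y hy
      simp only [Action.maxPre, iSup_le_iff] at hmax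
      exact_mod_cast hmax y ⟨hy, trivial⟩
    -- For a nondeterministic update, the infimum makes `f` nonnegative at every result in `S`, not
    -- merely on average.
    have hnn : ∀ y ∈ R, 0 ≤ f (ℓ', Function.update x i y) := by
      intro y hy
      by_cases hs : (ℓ', Function.update x i y) ∈ S
      · simp only [Action.minPre, le_iInf_iff] at hmin
        exact_mod_cast hmin y ⟨hy, hs⟩
      · exact hpos _ ⟨rfl, y, hy, rfl⟩ hs
    -- Nonemptiness of `R` provides one value of `f` between `0` and `b`.
    obtain ⟨y₀, hy₀⟩ := id h₁
    have hb : 0 ≤ b := (hnn y₀ hy₀).trans (hle y₀ hy₀)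
    refine ⟨?_, hb⟩
    rw [law_move_ndet, lintegral_map hF (measurable_mk_update ℓ' x i)]
    calc _ ≤ ∫⁻ _, ENNReal.ofReal b ∂q := by
          refine lintegral_mono_ae ((hq ℓ' g hg i R h₁ h₂ h₃ rfl).mono fun y hy => ?_)
          refine ENNReal.ofReal_le_ofReal ?_
          by_cases hs : (ℓ', Function.update x i y) ∈ S
          · simpa [hs] using hb
          · simpa [hs] using hle y hy
      _ = ENNReal.ofReal b := by simp

end OneStep

/-! ### Histories of all lengths as one measurable space. -/

section Sigma

variable {ι : Type*} {β : ι → Type*} [∀ i, MeasurableSpace (β i)]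

lemma measurable_sigmaMk (i : ι) : Measurable (Sigma.mk (β := β) i) := fun _ hs =>
  MeasurableSpace.measurableSet_iInf.1 hs i

lemma measurable_sigma {γ : Type*} [MeasurableSpace γ] {f : (Σ i, β i) → γ}
    (hf : ∀ i, Measurable fun b => f ⟨i, b⟩) : Measurable f := fun _ hs =>
  MeasurableSpace.measurableSet_iInf.2 fun i => hf i hs

end Sigma

section Histories

variable {L V Δ : Type*}

/-- Append a state to a sequence of states. -/
def Hist.snoc {m : ℕ} (h : Hist L V m) (s : State L V) : Hist L V (m + 1) :=
  fun i => if hi : i.1 ≤ m then h ⟨i.1, Finset.mem_Iic.2 hi⟩ else s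

lemma Hist.last_snoc {m : ℕ} (h : Hist L V m) (s : State L V) : (h.snoc s).last = s := by
  simp [Hist.snoc, Hist.last]

lemma measurable_snoc [MeasurableSpace L] (m : ℕ) :
    Measurable fun p : Hist L V m × State L V => p.1.snoc p.2 := by
  refine measurable_pi_lambda _ fun i => ?_
  by_cases hi : i.1 ≤ m
  · simpa [Hist.snoc, hi] using measurable_fst.eval
  · simpa [Hist.snoc, hi] using measurable_snd

lemma measurable_mk_snoc [MeasurableSpace L] {m : ℕ} (h : Hist L V m) :
    Measurable fun s : State L V => (⟨m + 1, h.snoc s⟩ : Σ m, Hist L V m) :=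
  (measurable_sigmaMk (m + 1)).comp ((measurable_snoc m).comp measurable_prodMk_left)

variable [DecidableEq V]

lemma PCFG.IsFinitePath.snoc {C : PCFG L V Δ} {m : ℕ} {h : Hist L V m} (hh : C.IsFinitePath h)
    {s : State L V} (hs : C.Succ h.last s) : C.IsFinitePath (h.snoc s) := by
  refine ⟨by simpa [Hist.snoc] using hh.1, fun i hi => ?_⟩
  by_cases hi' : i + 1 ≤ m
  · simpa [Hist.snoc, hi', (Nat.le_succ i).trans hi'] using hh.2 i hi'
  · obtain rfl : i = m := by lia
    simpa [Hist.snoc, Hist.last] using hs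

lemma PCFG.IsFinitePath.reachable_last {C : PCFG L V Δ} {m : ℕ} {h : Hist L V m}
    (hh : C.IsFinitePath h) : C.Reachable h.last :=
  ⟨m, h, hh, rfl⟩

lemma PCFG.Reachable.succ {C : PCFG L V Δ} {s s' : State L V} (hs : C.Reachable s)
    (hss' : C.Succ s s') : C.Reachable s' := by
  obtain ⟨m, h, hh, rfl⟩ := hs
  exact ⟨m + 1, h.snoc s', hh.snoc hss', h.last_snoc s'⟩

end Histories

/-! ### The truncated ranking functions. -/

section Ranking

variable {L V Δ : Type*}

lemma PCFG.measurableSet_enabled [MeasurableSpace L] [DiscreteMeasurableSpace L]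
    (C : PCFG L V Δ) (τ : Δ) :
    MeasurableSet {s : State L V | C.Enabled τ s} := by
  have hg : MeasurableSet (C.act τ).guard := by
    cases C.act τ with
    | branch δ h => exact MeasurableSet.univ
    | move ℓ' g hg up => exact hg
  exact (measurable_fst (measurableSet_singleton (C.src τ))).inter (measurable_snd hg) |>.congr
    (by ext s; simp [PCFG.Enabled, eq_comm])

variable [Fintype Δ]

lemma PCFG.mem_levelLE {C : PCFG L V Δ} {lev : Δ → ℕ} {j : ℕ} {s : State L V} :
    s ∈ C.levelLE lev j ↔ ∀ τ, C.Enabled τ s → lev τ ≤ j := by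
  simp [PCFG.levelLE, PCFG.stateLevel]

variable [MeasurableSpace L] [DiscreteMeasurableSpace L]

lemma PCFG.measurableSet_levelLE (C : PCFG L V Δ) (lev : Δ → ℕ) (j : ℕ) :
    MeasurableSet (C.levelLE lev j) := by
  have : C.levelLE lev j = ⋂ τ, {s | C.Enabled τ s → lev τ ≤ j} := by
    ext s; simp [PCFG.mem_levelLE]
  rw [this]
  refine MeasurableSet.iInter fun τ => ?_
  by_cases h : lev τ ≤ j
  · simp [h]
  · simp only [h, imp_false]
    exact (C.measurableSet_enabled τ).compl

/-- The function `f` on states of level above `j`, and zero on the other states. -/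
def PCFG.rank (C : PCFG L V Δ) (lev : Δ → ℕ) (j : ℕ) (f : State L V → ℝ) (s : State L V) : ℝ≥0∞ :=
  ENNReal.ofReal ((C.levelLE lev j)ᶜ.indicator f s)

lemma PCFG.measurable_rank (C : PCFG L V Δ) (lev : Δ → ℕ) (j : ℕ) {f : State L V → ℝ}
    (hf : Measurable f) : Measurable (C.rank lev j f) :=
  (hf.indicator (C.measurableSet_levelLE lev j).compl).ennreal_ofReal

variable [DecidableEq V] [Fintype L]

/-- In mean, the rank does not increase along transitions of level above `j`, and decreases by one
along transitions of level `j + 1`. -/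
lemma PCFG.lintegral_rank_le {C : PCFG L V Δ} {I : L → Set (V → ℝ)} (hI : C.IsInvariant I)
    {n : ℕ} {η : Fin n → State L V → ℝ} (hη : ∀ j, Measurable (η j)) {lev : Δ → ℕ}
    (hlev : ∀ τ, lev τ = 0 ↔ C.IsOutLoop τ)
    (hcond : ∀ τ, C.src τ ≠ C.out → C.PRank I η lev τ ∧ C.PNneg I η lev τ ∧ C.ExpNneg I η lev τ)
    (j : Fin n) {τ : Δ} (hτ : (j : ℕ) + 1 ≤ lev τ) {s : State L V} (hs : C.Reachable s)
    (hen : C.Enabled τ s) {q : Measure ℝ} [IsProbabilityMeasure q]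
    (hq : (C.act τ).Admissible q) :
    (if lev τ = j + 1 then 1 else 0) +
      ∫⁻ s', C.rank lev j (η j) s' ∂((C.act τ).law s.2 q) ≤ C.rank lev j (η j) s := by
  -- Transitions leaving the terminal location are self-loops there, hence of level zero.
  have hsrc : ∀ τ', (j : ℕ) + 1 ≤ lev τ' → C.src τ' ≠ C.out := fun τ' h h' => by
    have := (hlev τ').2 ⟨h', C.out_loop τ' h'⟩
    lia
  obtain ⟨ℓ, x⟩ := s
  obtain ⟨hℓ, hx⟩ := hen
  obtain rfl : C.src τ = ℓ := hℓ
  have hxI : x ∈ I (C.src τ) ∩ (C.act τ).guard := ⟨hI.2 _ hs, hx⟩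
  obtain ⟨hrank, -, hexp⟩ := hcond τ (hsrc τ hτ)
  -- `c` is the guaranteed decrease; it merges the two clauses of P-RANK.
  set c : ℝ := if lev τ = j + 1 then 1 else 0 with hc
  have hc0 : 0 ≤ c := by rw [hc]; split_ifs <;> simp
  have hmax : (C.act τ).maxPre (η j) Set.univ x ≤ ((η j (C.src τ, x) - c : ℝ) : EReal) := by
    rw [hc]
    split_ifs with h
    · exact (hrank x hxI j).1 h.symm
    · simpa using (hrank x hxI j).2 (by lia)
  -- A state of level above `j` enables some `τ'` of level at least `j + 1`, and P-NNEG for `τ'`,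
  -- rather than for `τ`, applies there because the state is reachable.
  have hpos : ∀ s', (C.act τ).Result x s' → s' ∉ C.levelLE lev j → 0 ≤ η j s' := by
    intro s' hres hs'
    rw [PCFG.mem_levelLE] at hs'
    push Not at hs'
    obtain ⟨τ', ⟨hsrc', hguard'⟩, hlev'⟩ := hs'
    have hreach : C.Reachable s' := hs.succ ⟨τ, ⟨rfl, hx⟩, hres⟩
    have := (hcond τ' (hsrc τ' hlev')).2.1 s'.2 ⟨by rw [hsrc']; exact hI.2 _ hreach, hguard'⟩ j
      hlev'
    rwa [hsrc'] at this
  obtain ⟨hle, hnn⟩ := (C.act τ).lintegral_law_le x hq (hη j) (C.measurableSet_levelLE lev j) hpos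
    hmax (hexp x hxI j hτ)
  have hmem : (C.src τ, x) ∉ C.levelLE lev j := fun h => by
    have := PCFG.mem_levelLE.1 h τ ⟨rfl, hx⟩
    lia
  have hcE : (if lev τ = j + 1 then 1 else 0 : ℝ≥0∞) = ENNReal.ofReal c := by
    rw [hc]; split_ifs <;> simp
  -- Since `η j - c` is nonnegative as well, `ENNReal.ofReal` truncates nothing and the two terms
  -- add up exactly.
  calc _ ≤ ENNReal.ofReal c + ENNReal.ofReal (η j (C.src τ, x) - c) := by
        rw [hcE]; exact add_le_add le_rfl hle
    _ = C.rank lev j (η j) (C.src τ, x) := by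
        rw [← ENNReal.ofReal_add hc0 hnn, PCFG.rank, Set.indicator_of_mem hmem]
        congr 1; ring

end Ranking

/-! ### Killed processes on histories and their transience. -/

namespace Scheduler

variable {L V Δ : Type*} [DecidableEq V] [MeasurableSpace L] {C : PCFG L V Δ}

lemma admissible_val (σ : Scheduler C) {m : ℕ} {h : Hist L V m} (hh : C.IsFinitePath h) {τ : Δ}
    (hτ : C.Enabled τ h.last) : (C.act τ).Admissible (σ.val m τ h) :=
  σ.val_mem m h τ hh hτ

lemma enabled_of_trans_ne_zero (σ : Scheduler C) {m : ℕ} {h : Hist L V m}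
    (hh : C.IsFinitePath h) {τ : Δ} (hτ : σ.trans m h τ ≠ 0) : C.Enabled τ h.last :=
  σ.trans_enabled m h hh τ ((PMF.mem_support_iff _ _).2 hτ)

instance (σ : Scheduler C) (m : ℕ) (τ : Δ) : IsMarkovKernel (σ.val m τ) := σ.isMarkov_val m τ

/-- The law of the next state if the transition `τ` is executed. -/
def lawKernel (σ : Scheduler C) (m : ℕ) (τ : Δ) : Kernel (Hist L V m) (State L V) where
  toFun h := (C.act τ).law h.last.2 (σ.val m τ h)
  measurable' := (C.act τ).measurable_law (measurable_snd.comp (measurable_last m)) (σ.val m τ)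

instance (σ : Scheduler C) (m : ℕ) (τ : Δ) : IsMarkovKernel (σ.lawKernel m τ) where
  isProbabilityMeasure h := (C.act τ).isProbabilityMeasure_law h.last.2 (σ.val m τ h)

/-- The sub-Markov kernel on histories that executes the transition `τ` with the probability
given by the scheduler, and is killed otherwise. -/
def transKernel (σ : Scheduler C) (τ : Δ) : Kernel (Σ m, Hist L V m) (Σ m, Hist L V m) where
  toFun e := σ.trans e.1 e.2 τ •
    (σ.lawKernel e.1 τ e.2).map fun s => ⟨e.1 + 1, e.2.snoc s⟩
  measurable' := by
    refine measurable_sigma fun m => ?_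
    refine Measure.measurable_of_measurable_coe _ fun A hA => ?_
    simp only [Measure.smul_apply, smul_eq_mul]
    refine (σ.measurable_trans m τ).mul ?_
    simp_rw [Measure.map_apply (measurable_mk_snoc _) hA]
    exact Kernel.measurable_kernel_prodMk_left (κ := σ.lawKernel m τ)
      (((measurable_sigmaMk (m + 1)).comp (measurable_snoc m)) hA)

lemma lintegral_transKernel (σ : Scheduler C) (τ : Δ) (e : Σ m, Hist L V m)
    {F : (Σ m, Hist L V m) → ℝ≥0∞} (hF : Measurable F) :
    ∫⁻ e', F e' ∂(σ.transKernel τ e) =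
      σ.trans e.1 e.2 τ * ∫⁻ s, F ⟨e.1 + 1, e.2.snoc s⟩ ∂(σ.lawKernel e.1 τ e.2) := by
  change ∫⁻ e', F e' ∂(σ.trans e.1 e.2 τ • _) = _
  rw [lintegral_smul_measure, lintegral_map hF (measurable_mk_snoc _), smul_eq_mul]

lemma transKernel_univ (σ : Scheduler C) (τ : Δ) (e : Σ m, Hist L V m) :
    σ.transKernel τ e Set.univ = σ.trans e.1 e.2 τ := by
  simpa using σ.lintegral_transKernel τ e measurable_one

/-- The sub-Markov kernel on histories that is killed if a transition outside `A` is chosen. -/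
def setKernel (σ : Scheduler C) (A : Finset Δ) : Kernel (Σ m, Hist L V m) (Σ m, Hist L V m) :=
  ∑ τ ∈ A, σ.transKernel τ

lemma setKernel_apply (σ : Scheduler C) (A : Finset Δ) (e : Σ m, Hist L V m)
    (M : Set (Σ m, Hist L V m)) : σ.setKernel A e M = ∑ τ ∈ A, σ.transKernel τ e M := by
  rw [setKernel, Kernel.finsetSum_apply']

lemma lintegral_setKernel (σ : Scheduler C) (A : Finset Δ) (e : Σ m, Hist L V m)
    (F : (Σ m, Hist L V m) → ℝ≥0∞) :
    ∫⁻ e', F e' ∂(σ.setKernel A e) = ∑ τ ∈ A, ∫⁻ e', F e' ∂(σ.transKernel τ e) := by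
  rw [setKernel, sum_apply, lintegral_finsetSum_measure]

lemma setKernel_univ_le_one [Fintype Δ] (σ : Scheduler C) (A : Finset Δ) (e : Σ m, Hist L V m) :
    σ.setKernel A e Set.univ ≤ 1 := by
  simp only [setKernel_apply, transKernel_univ]
  exact (ENNReal.sum_le_tsum A).trans (σ.trans e.1 e.2).tsum_coe.le

/-- The set of finite paths. -/
def paths (C : PCFG L V Δ) : Set (Σ m, Hist L V m) := {e | C.IsFinitePath e.2}

/-- At a finite path, a transition of positive probability is enabled and its law is carried by
every measurable set containing all its results; each such result extends the path to a finite path.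
-/
lemma preserves_setKernel [DiscreteMeasurableSpace L] (σ : Scheduler C) (A : Finset Δ) :
    Preserves (σ.setKernel A) (paths C) := by
  rintro ⟨m, h⟩ hh M hM hPM
  rw [setKernel_apply]
  refine Finset.sum_eq_zero fun τ _ => ?_
  rw [← lintegral_indicator_one hM.compl, σ.lintegral_transKernel τ _
    (measurable_one.indicator hM.compl)]
  rcases eq_or_ne (σ.trans m h τ) 0 with h0 | h0
  · simp [h0]
  have hen := σ.enabled_of_trans_ne_zero hh h0
  have hφ := measurable_mk_snoc h
  have := (C.act τ).law_compl_eq_zero h.last.2 (σ.admissible_val hh hen) (hφ hM)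
    fun s hs => hPM (PCFG.IsFinitePath.snoc hh ⟨τ, hen, hs⟩)
  rw [show (fun s => Mᶜ.indicator (1 : (Σ m, Hist L V m) → ℝ≥0∞) ⟨m + 1, h.snoc s⟩) =
    ((fun s => (⟨m + 1, h.snoc s⟩ : Σ m, Hist L V m)) ⁻¹' M)ᶜ.indicator 1 from rfl,
    lintegral_indicator_one (hφ hM).compl]
  exact mul_eq_zero_of_right _ this

variable [Fintype L] [DiscreteMeasurableSpace L] [Fintype Δ]

/-- A particle that is killed at the first transition of level below `k` is almost surely killed. -/
lemma isTransientOn_setKernel (σ : Scheduler C) {I : L → Set (V → ℝ)} (hI : C.IsInvariant I)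
    {n : ℕ} {η : Fin n → State L V → ℝ} (hη : ∀ j, Measurable (η j)) {lev : Δ → ℕ}
    (hn : ∀ τ, lev τ ≤ n) (hlev : ∀ τ, lev τ = 0 ↔ C.IsOutLoop τ)
    (hcond : ∀ τ, C.src τ ≠ C.out → C.PRank I η lev τ ∧ C.PNneg I η lev τ ∧ C.ExpNneg I η lev τ)
    {k : ℕ} (hk : k ≤ n) :
    IsTransientOn (σ.setKernel {τ | k + 1 ≤ lev τ}) (paths C) := by
  induction hk using Nat.decreasingInduction with
  | self =>
    intro v _ _ hle e he
    -- No level exceeds `n`, so the kernel is zero and subharmonicity reads `v e ≤ 0`.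
    have : (Finset.univ.filter fun τ => n + 1 ≤ lev τ) = ∅ := by
      ext τ; simpa using Nat.lt_succ_of_le (hn τ)
    have hle := hle e he
    rw [this, lintegral_setKernel, Finset.sum_empty] at hle
    exact le_zero_iff.1 hle
  | of_succ k hk ih =>
    have hsplit : (Finset.univ.filter fun τ => k + 1 ≤ lev τ) =
        (Finset.univ.filter fun τ => k + 1 + 1 ≤ lev τ).disjUnion
          (Finset.univ.filter fun τ => lev τ = k + 1)
          (Finset.disjoint_filter.2 fun τ _ h h' => by lia) := by
      ext τ; simp; lia
    have hadd : σ.setKernel {τ | k + 1 ≤ lev τ} =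
        σ.setKernel {τ | k + 1 + 1 ≤ lev τ} + σ.setKernel {τ | lev τ = k + 1} := by
      rw [hsplit, setKernel, Finset.sum_disjUnion]; rfl
    rw [hadd]
    have hrank := C.measurable_rank lev k (hη ⟨k, hk⟩)
    have hg : Measurable fun e : Σ m, Hist L V m => C.rank lev k (η ⟨k, hk⟩) e.2.last :=
      measurable_sigma fun m => hrank.comp (measurable_last m)
    refine ih.add (σ.preserves_setKernel _) (σ.preserves_setKernel _)
      (σ.setKernel_univ_le_one _) hg (fun e _ => ENNReal.ofReal_ne_top) ?_
    rintro ⟨m, h⟩ hh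
    rw [← hadd, lintegral_setKernel, setKernel_apply]
    -- The mass of the `κ₂`-steps is written as a sum over all allowed transitions, so that the
    -- inequality can be checked one transition at a time.
    have hsub : ∑ τ with lev τ = k + 1, σ.transKernel τ ⟨m, h⟩ Set.univ =
        ∑ τ with k + 1 ≤ lev τ, σ.trans m h τ * (if lev τ = k + 1 then 1 else 0) := by
      simp only [mul_ite, mul_one, mul_zero, transKernel_univ]
      rw [← Finset.sum_filter, Finset.filter_filter]
      exact Finset.sum_congr (by ext τ; simp; lia) fun _ _ => rfl
    rw [hsub, ← Finset.sum_add_distrib]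
    calc _ ≤ ∑ τ with k + 1 ≤ lev τ, σ.trans m h τ * C.rank lev k (η ⟨k, hk⟩) h.last := by
          refine Finset.sum_le_sum fun τ hτ => ?_
          rw [σ.lintegral_transKernel τ _ hg, ← mul_add]
          rcases eq_or_ne (σ.trans m h τ) 0 with h0 | h0
          · simp [h0]
          have hen := σ.enabled_of_trans_ne_zero hh h0
          gcongr
          simp only [Hist.last_snoc]
          exact PCFG.lintegral_rank_le hI hη hlev hcond ⟨k, hk⟩ (Finset.mem_filter.1 hτ).2
            (PCFG.IsFinitePath.reachable_last hh) hen (σ.admissible_val hh hen)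
      -- The allowed transitions have total probability at most one; killing only helps.
      _ ≤ 1 * C.rank lev k (η ⟨k, hk⟩) h.last := by
          rw [← Finset.sum_mul]
          gcongr
          exact (ENNReal.sum_le_tsum _).trans (σ.trans m h).tsum_coe.le
      _ = _ := one_mul _

end Scheduler

/-! ### Runs and the probability of avoiding the terminal location. -/

lemma measurableSet_forall_fst_ne {L V : Type*} [MeasurableSpace L] [DiscreteMeasurableSpace L]
    (ℓ : L) : MeasurableSet {ρ : ℕ → State L V | ∀ n, (ρ n).1 ≠ ℓ} := by
  rw [Set.ofPred_forall]
  exact MeasurableSet.iInter fun n =>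
    (measurable_fst.comp (measurable_pi_apply n)) (measurableSet_singleton ℓ).compl

/-- The law of a trajectory satisfies the one-step Markov property. -/
lemma traj_apply_eq_lintegral {X : ℕ → Type*} [∀ n, MeasurableSpace (X n)]
    (κ : (n : ℕ) → Kernel ((i : Finset.Iic n) → X i) (X (n + 1))) [∀ n, IsMarkovKernel (κ n)]
    (m : ℕ) (h : (i : Finset.Iic m) → X i) {N : Set ((n : ℕ) → X n)} (hN : MeasurableSet N) :
    Kernel.traj κ m h N = ∫⁻ s, Kernel.traj κ (m + 1)
      (IicProdIoc m (m + 1) (h, MeasurableEquiv.piSingleton m s)) N ∂(κ m h) := by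
  have hm : Measurable fun h' => Kernel.traj κ (m + 1) h' N := Kernel.measurable_coe _ hN
  have hm' : Measurable fun p => Kernel.traj κ (m + 1) (IicProdIoc m (m + 1) p) N :=
    hm.comp measurable_IicProdIoc
  rw [← Kernel.traj_comp_partialTraj m.le_succ, Kernel.comp_apply' _ _ _ hN,
    Kernel.partialTraj_succ_self, Kernel.lintegral_map _ (by fun_prop) _ hm,
    Kernel.lintegral_id_prod hm']
  exact Kernel.lintegral_map _ (by fun_prop) _ (hm'.comp measurable_prodMk_left)

lemma iicProdIoc_piSingleton {L V : Type*} [MeasurableSpace L] {m : ℕ} (h : Hist L V m)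
    (s : State L V) : IicProdIoc (X := fun _ => State L V) m (m + 1)
      (h, MeasurableEquiv.piSingleton (X := fun _ => State L V) m s) = h.snoc s := by
  funext i
  by_cases hi : i.1 ≤ m
  · simp [IicProdIoc, Hist.snoc, hi]
  · simp [IicProdIoc, Hist.snoc, hi, MeasurableEquiv.piSingleton]

namespace Scheduler

variable {L V Δ : Type*} [DecidableEq V] [MeasurableSpace L] [Fintype Δ] {C : PCFG L V Δ}

/-- The law of the run that continues the history `h`. -/
def runKernel (σ : Scheduler C) (m : ℕ) : Kernel (Hist L V m) (ℕ → State L V) :=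
  Kernel.traj (X := fun _ => State L V) σ.step m

lemma runKernel_eq_lintegral_step (σ : Scheduler C) (m : ℕ) (h : Hist L V m)
    {N : Set (ℕ → State L V)} (hN : MeasurableSet N) :
    σ.runKernel m h N = ∫⁻ s, σ.runKernel (m + 1) (h.snoc s) N ∂(σ.step m h) := by
  refine (traj_apply_eq_lintegral (X := fun _ => State L V) σ.step m h hN).trans ?_
  refine lintegral_congr fun s => ?_
  rw [iicProdIoc_piSingleton]
  rfl

lemma lintegral_step (σ : Scheduler C) (m : ℕ) (h : Hist L V m) (F : State L V → ℝ≥0∞) :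
    ∫⁻ s, F s ∂(σ.step m h) = ∑ τ, σ.trans m h τ * ∫⁻ s, F s ∂(σ.lawKernel m τ h) := by
  change ∫⁻ s, F s ∂(∑ τ, σ.trans m h τ • σ.lawKernel m τ h) = _
  simp only [lintegral_finsetSum_measure, lintegral_smul_measure, smul_eq_mul]

/-- The initial segment of a continued run is almost surely the given history, so its last state
already violates the constraint. -/
lemma runKernel_eq_zero_of_last (σ : Scheduler C) {m : ℕ} {h : Hist L V m}
    {B : Set (State L V)} (hB : MeasurableSet B) (hh : h.last ∉ B) :
    σ.runKernel m h {ρ | ∀ n, ρ n ∈ B} = 0 := by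
  have hBm : MeasurableSet {h' : Hist L V m | h'.last ∈ B} := measurable_last m hB
  have key := Kernel.traj_map_frestrictLe_apply (X := fun _ => State L V) (κ := σ.step) m m h
  rw [Kernel.partialTraj_self, Kernel.id_apply] at key
  refine measure_mono_null (t := Preorder.frestrictLe m ⁻¹' {h' : Hist L V m | h'.last ∈ B})
    (fun ρ hρ => hρ m) ?_
  rw [runKernel, ← Measure.map_apply (by fun_prop) hBm, key, Measure.dirac_apply' _ hBm]
  simpa using hh

instance (σ : Scheduler C) (m : ℕ) : IsMarkovKernel (σ.runKernel m) := by
  unfold runKernel; infer_instance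

/-- The probability to avoid the terminal location is subharmonic for the kernel that is killed
at transitions of level zero. -/
lemma runKernel_avoid_out_le [DiscreteMeasurableSpace L] (σ : Scheduler C)
    {lev : Δ → ℕ} (hlev : ∀ τ, lev τ = 0 ↔ C.IsOutLoop τ) {e : Σ m, Hist L V m}
    (he : e ∈ paths C) :
    σ.runKernel e.1 e.2 {ρ | ∀ n, (ρ n).1 ≠ C.out} ≤
      ∫⁻ e', σ.runKernel e'.1 e'.2 {ρ | ∀ n, (ρ n).1 ≠ C.out}
        ∂(σ.setKernel {τ | 0 + 1 ≤ lev τ} e) := by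
  obtain ⟨m, h⟩ := e
  have hNm := measurableSet_forall_fst_ne (V := V) C.out
  -- In the terminal location the left side is zero. Elsewhere no transition of level zero is
  -- enabled, so nothing is killed and the Markov property gives the bound.
  by_cases hout : h.last.1 = C.out
  · have := σ.runKernel_eq_zero_of_last (h := h) (B := {s | s.1 ≠ C.out})
      (measurable_fst (measurableSet_singleton C.out).compl) (by simpa using hout)
    exact (this.trans_le zero_le)
  have hm : Measurable fun e' : Σ m, Hist L V m =>
      σ.runKernel e'.1 e'.2 {ρ | ∀ n, (ρ n).1 ≠ C.out} :=
    measurable_sigma fun m => (σ.runKernel m).measurable_coe hNm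
  rw [σ.runKernel_eq_lintegral_step m h hNm, σ.lintegral_step, σ.lintegral_setKernel]
  rw [← Finset.sum_subset (Finset.filter_subset (fun τ => 0 + 1 ≤ lev τ) Finset.univ)]
  · exact Finset.sum_le_sum fun τ _ => (σ.lintegral_transKernel τ ⟨m, h⟩ hm).ge
  · intro τ _ hτ
    have h0 : lev τ = 0 := by simpa using hτ
    have : σ.trans m h τ = 0 := by
      by_contra hne
      exact hout ((σ.enabled_of_trans_ne_zero he hne).1 ▸ ((hlev τ).1 h0).1)
    rw [this, zero_mul]

end Scheduler

end GLexRSM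

end

/-! ### Almost-sure termination. -/

theorem theorem2 {L V Δ : Type*} [Fintype L] [MeasurableSpace L] [DiscreteMeasurableSpace L]
    [Fintype V] [DecidableEq V] [Fintype Δ]
    (C : GLexRSM.PCFG L V Δ) (I : L → Set (V → ℝ)) (hI : C.IsInvariant I)
    (n : ℕ) (η : Fin n → GLexRSM.State L V → ℝ) (hη : C.IsGLexRSMMap I η) :
    C.TerminatesAlmostSurely := by
  obtain ⟨hηm, lev, hn, hlev, hcond⟩ := hη
  intro σ x
  have htrans := σ.isTransientOn_setKernel hI
    (fun j => measurable_from_prod_countable_right (hηm j)) hn hlev hcond (Nat.zero_le n)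
  have hNm := GLexRSM.measurableSet_forall_fst_ne (V := V) C.out
  -- Transience at `k = 0` is applied to the avoidance probability, at the history consisting of the
  -- initial state alone; it is a finite path because it has no steps to check.
  have hzero : σ.runKernel 0 (fun _ => (C.init, x)) {ρ | ∀ n, (ρ n).1 ≠ C.out} = 0 :=
    htrans (fun e => σ.runKernel e.1 e.2 {ρ | ∀ n, (ρ n).1 ≠ C.out})
      (GLexRSM.measurable_sigma fun m => (σ.runKernel m).measurable_coe hNm) (fun e => prob_le_one)
      (fun e he => σ.runKernel_avoid_out_le hlev he) ⟨0, fun _ => (C.init, x)⟩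
      ⟨rfl, fun i hi => by lia⟩
  have hprob : IsProbabilityMeasure (σ.runMeasure x) := by
    unfold GLexRSM.Scheduler.runMeasure; infer_instance
  have hcompl : {ρ : ℕ → GLexRSM.State L V | ∃ n, (ρ n).1 = C.out}ᶜ =
      {ρ | ∀ n, (ρ n).1 ≠ C.out} := by
    ext ρ; simp
  refine (prob_compl_eq_zero_iff ?_).1 ?_
  · rw [← MeasurableSet.compl_iff, hcompl]
    exact hNm
  · rw [hcompl]
    exact hzero
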